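/- Let $X,Y$ be Hausdorff topological spaces (for instance compact Hausdorff spaces) with their Borel $\sigma$-algebras. Let $J\in\mathbb N$ and let $\bar\mu=(\mu^{(1)},\dots,\mu^{(J)})$ and $\bar\nu=(\nu^{(1)},\dots,\nu^{(J)})$ be $\mathbb R_+^J$-valued measures on $X$ and $Y$, that is, $J$-tuples of finite non-negative regular Borel measures. Put $\mu:=\sum_{j=1}^J\mu^{(j)}$ and $\nu:=\sum_{j=1}^J\nu^{(j)}$, and let $\frac{d\bar\mu}{d\mu}$, $\frac{d\bar\nu}{d\nu}$ be the vectors of Radon–Nikodym derivatives. Say that $(X,\bar\mu)$ *dominates* $(Y,\bar\nu)$, written $(X,\bar\mu)\succ(Y,\bar\nu)$, if there is a non-negative measure $\pi$ on $X\times Y$ (with the product $\sigma$-algebra) whose first marginal is $\mu$ and which satisfies $$\int_{x\in X}\frac{d\mu^{(j)}}{d\mu}(x)\,\pi(dx\,dy)=\nu^{(j)}(dy),\qquad j=1,\dots,J .$$ For $N\ge 1$, a *weak partition* of order $N$ of a measure $m$ is an $N$-tuple $(m_1,\dots,m_N)$ of non-negative measures with $\sum_{i=1}^N m_i=m$. Let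 $$\Delta_N(\bar\mu):=\Big\{\Big(\int_X\frac{d\mu^{(j)}}{d\mu}\,d\mu_i\Big)_{1\le i\le N,\,1\le j\le J}\in\mathbb R^{N\times J}:\ (\mu_1,\dots,\mu_N)\text{ is a weak partition of }\mu\Big\},$$ and define $\Delta_N(\bar\nu)$ in the same way. Weak partitions $(\mu_i)_{i\le N}$ of $\mu$ and $(\nu_i)_{i\le N}$ of $\nu$ are *$\bar\mu$–$\bar\nu$ congruent* if $$\int_X\frac{d\bar\mu}{d\mu}\,d\mu_i=\int_Y\frac{d\bar\nu}{d\nu}\,d\nu_i,\qquad i=1,\dots,N .$$ Then: 1. $(X,\bar\mu)\succ(Y,\bar\nu)$ if and only if $\Delta_N(\bar\mu)\supseteq\Delta_N(\bar\nu)$ for every $N\ge1$. 2. $(X,\bar\mu)\succ(Y,\bar\nu)$ if and only if for every $N\ge 1$ and every weak partition $(\nu_1,\dots,\nu_N)$ of $\nu$ there is a weak partition $(\mu_1,\dots,\mu_N)$ of $\mu$ such that the two are $\bar\mu$–$\bar\nu$ congruent. -/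

import Mathlib

open MeasureTheory
open scoped ENNReal

namespace VectorDominance

/-- An `ℝ₊^J`-valued measure on `X` is a family of `J` (finite) measures on `X`; this is the total
measure `|μ̄| = ∑ j, μ^(j)`. -/
noncomputable def total {X : Type*} [MeasurableSpace X] {J : ℕ} (μ : Fin J → Measure X) :
    Measure X :=
  ∑ j, μ j

/-- `(X, μ̄) ≻ (Y, ν̄)`: there is a measure `π` on `X × Y` whose first marginal is `|μ̄|` and which
satisfies `∫_{x ∈ X} (dμ^(j)/d|μ̄|)(x) π(dx dy) = ν^(j)(dy)` for every `j`. -/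
def Dominates {X Y : Type*} [MeasurableSpace X] [MeasurableSpace Y] {J : ℕ}
    (μ : Fin J → Measure X) (ν : Fin J → Measure Y) : Prop :=
  ∃ π : Measure (X × Y), π.fst = total μ ∧
    ∀ j, (π.withDensity fun z => (μ j).rnDeriv (total μ) z.1).snd = ν j

/-- `(p_1, …, p_N)` is a weak partition of the measure `m`. (For `m` finite and regular, each
`p_i ≤ m` is automatically finite and regular.) -/
def IsWeakPartition {X : Type*} [MeasurableSpace X] {N : ℕ} (m : Measure X)
    (p : Fin N → Measure X) : Prop :=
  ∑ i, p i = m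

/-- The `N × J` matrix with entries `∫ (dμ^(j)/d|μ̄|) dp_i`. -/
noncomputable def momentMatrix {X : Type*} [MeasurableSpace X] {J N : ℕ}
    (μ : Fin J → Measure X) (p : Fin N → Measure X) : Matrix (Fin N) (Fin J) ℝ :=
  Matrix.of fun i j => ∫ x, ((μ j).rnDeriv (total μ) x).toReal ∂(p i)

/-- The feasibility set `Δ_N(μ̄)`. -/
def feasibilitySet {X : Type*} [MeasurableSpace X] {J : ℕ} (N : ℕ) (μ : Fin J → Measure X) :
    Set (Matrix (Fin N) (Fin J) ℝ) :=
  {M | ∃ p : Fin N → Measure X, IsWeakPartition (total μ) p ∧ momentMatrix μ p = M}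

/-- The families `p` on `X` and `q` on `Y` are `μ̄`–`ν̄` congruent:
`∫_X (dμ̄/d|μ̄|) dp_i = ∫_Y (dν̄/d|ν̄|) dq_i` in `ℝ^J`, for every `i`. -/
def Congruent {X Y : Type*} [MeasurableSpace X] [MeasurableSpace Y] {J N : ℕ}
    (μ : Fin J → Measure X) (ν : Fin J → Measure Y)
    (p : Fin N → Measure X) (q : Fin N → Measure Y) : Prop :=
  ∀ i, ∀ j, ∫ x, ((μ j).rnDeriv (total μ) x).toReal ∂(p i) =
    ∫ y, ((ν j).rnDeriv (total ν) y).toReal ∂(q i)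

end VectorDominance

/-!
Write `f j` for the density of `μ j` with respect to `|μ̄| = total μ`. These densities sum to `1`
almost everywhere, which makes every measure `π` witnessing domination a coupling of `|μ̄|` and
`|ν̄|`. Inclusion of the feasibility sets is a rewording of the existence of congruent weak
partitions (`feasibilitySet_subset_iff`), so only the second equivalence needs an argument.

Given `π` and a weak partition `q` of `|ν̄|`, weighting `π` by the density `dq_i / d|ν̄|` of the
second variable and taking first marginals gives a congruent weak partition of `|μ̄|`
(`Dominates.exists_congruent`).

Conversely, finitely many measurable sets of `Y` generate a finite partition of `Y` into cells. A
weak partition `p` of `|μ̄|` congruent to the restrictions of `|ν̄|` to the cells gives the coupling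
`∑ i, p i ⊗ |ν̄|(· | cell i)`, which satisfies the defining equations of domination on these
finitely many sets (`exists_coupling_of_congruent`). A limit is then taken over all finite families
of measurable sets. `X` and `Y` are arbitrary Hausdorff spaces and their product carries the product
`σ`-algebra, so neither disintegration nor weak convergence is at hand; the limit is taken setwise,
along an ultrafilter. It is a finitely additive content with marginals `|μ̄|` and `|ν̄|`. These are
inner regular for compact sets, so on finite unions of rectangles the content is approximated from
inside by compact sets and hence continuous at `∅`, and Carathéodory's theorem extends it to a
measure `π` (`exists_measure_eq_content`, `exists_measure_tendsto_prod`).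

In the limit, Fatou's lemma for setwise convergence gives `∫ f j (x) π(dx, B) ≤ ν j B` for every
`j`. The sums over `j` of both sides equal `|ν̄| B < ∞`, so equality holds for each `j`
(`dominates_of_forall_exists_congruent`).
-/

open Set Filter Topology Function

namespace VectorDominance

/-! ### Finitely additive contents -/

section Content

theorem isSetAlgebra_measurableSet {Z : Type*} [MeasurableSpace Z] :
    IsSetAlgebra {s : Set Z | MeasurableSet s} where
  empty_mem := MeasurableSet.empty
  compl_mem := fun _ h => MeasurableSet.compl h
  union_mem := fun _ _ h h' => MeasurableSet.union h h'

variable {Z : Type*} [MeasurableSpace Z] {m : AddContent ℝ≥0∞ {s : Set Z | MeasurableSet s}}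

theorem content_mono {s t : Set Z} (hs : MeasurableSet s) (ht : MeasurableSet t) (h : s ⊆ t) :
    m s ≤ m t :=
  addContent_mono isSetAlgebra_measurableSet.isSetRing.isSetSemiring hs ht h

theorem content_union_le {s t : Set Z} (hs : MeasurableSet s) (ht : MeasurableSet t) :
    m (s ∪ t) ≤ m s + m t :=
  addContent_union_le isSetAlgebra_measurableSet.isSetRing hs ht

end Content

/-! ### Extending a compact-regular content to a measure -/

section Extension

variable {Z : Type*} [TopologicalSpace Z] [MeasurableSpace Z]

/-- `s` can be exhausted by measurable compact subsets, up to a set of arbitrarily small `m`. The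
measurability of `K` has to be required, since the `σ`-algebra need not contain the Borel sets. -/
def CompactApprox (m : Set Z → ℝ≥0∞) (s : Set Z) : Prop :=
  ∀ ε : ℝ≥0∞, ε ≠ 0 → ∃ K ⊆ s, IsCompact K ∧ MeasurableSet K ∧ m (s \ K) ≤ ε

variable {m : AddContent ℝ≥0∞ {s : Set Z | MeasurableSet s}}

theorem CompactApprox.union {s t : Set Z} (hs : MeasurableSet s) (ht : MeasurableSet t)
    (as : CompactApprox m s) (ht' : CompactApprox m t) : CompactApprox m (s ∪ t) := by
  intro ε hε
  have hε2 : ε / 2 ≠ 0 := (ENNReal.half_pos hε).ne'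
  obtain ⟨K, hKs, hK, mK, hmK⟩ := as _ hε2
  obtain ⟨L, hLt, hL, mL, hmL⟩ := ht' _ hε2
  refine ⟨K ∪ L, union_subset_union hKs hLt, hK.union hL, mK.union mL, ?_⟩
  have hsub : (s ∪ t) \ (K ∪ L) ⊆ (s \ K) ∪ (t \ L) := by
    intro x hx
    simp only [Set.mem_sdiff, mem_union] at hx ⊢
    tauto
  calc m ((s ∪ t) \ (K ∪ L)) ≤ m ((s \ K) ∪ (t \ L)) :=
        content_mono ((hs.union ht).diff (mK.union mL)) ((hs.diff mK).union (ht.diff mL)) hsub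
    _ ≤ m (s \ K) + m (t \ L) := content_union_le (hs.diff mK) (ht.diff mL)
    _ ≤ ε / 2 + ε / 2 := add_le_add hmK hmL
    _ = ε := ENNReal.add_halves ε

theorem CompactApprox.inter [T2Space Z] {s t : Set Z} (hs : MeasurableSet s)
    (ht : MeasurableSet t) (as : CompactApprox m s) (ht' : CompactApprox m t) :
    CompactApprox m (s ∩ t) := by
  intro ε hε
  have hε2 : ε / 2 ≠ 0 := (ENNReal.half_pos hε).ne'
  obtain ⟨K, hKs, hK, mK, hmK⟩ := as _ hε2
  obtain ⟨L, hLt, hL, mL, hmL⟩ := ht' _ hε2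
  refine ⟨K ∩ L, inter_subset_inter hKs hLt, hK.inter hL, mK.inter mL, ?_⟩
  have hsub : (s ∩ t) \ (K ∩ L) ⊆ (s \ K) ∪ (t \ L) := by
    intro x hx
    simp only [Set.mem_sdiff, mem_inter_iff, mem_union] at hx ⊢
    tauto
  calc m ((s ∩ t) \ (K ∩ L)) ≤ m ((s \ K) ∪ (t \ L)) :=
        content_mono ((hs.inter ht).diff (mK.inter mL)) ((hs.diff mK).union (ht.diff mL)) hsub
    _ ≤ m (s \ K) + m (t \ L) := content_union_le (hs.diff mK) (ht.diff mL)
    _ ≤ ε / 2 + ε / 2 := add_le_add hmK hmL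
    _ = ε := ENNReal.add_halves ε

/-- The compact-class argument: a content is continuous at `∅` along sets that it approximates
from inside by compact sets. -/
theorem tendsto_content_zero_of_compactApprox [T2Space Z] {s : ℕ → Set Z}
    (hs : ∀ n, MeasurableSet (s n)) (as : ∀ n, CompactApprox m (s n)) (anti : Antitone s)
    (hempty : ⋂ n, s n = ∅) : Tendsto (fun n => m (s n)) atTop (𝓝 0) := by
  rw [ENNReal.tendsto_nhds_zero]
  intro ε hε
  obtain ⟨δ, hδ, hδε⟩ := ENNReal.exists_pos_sum_of_countable' hε.ne' ℕ
  choose K hKs hK mK hmK using fun n => as n (δ n) (hδ n).ne'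
  -- a finite intersection of the compact sets is already empty
  obtain ⟨n, hn⟩ : ∃ n, ⋂ i ∈ Finset.range (n + 1), K i = ∅ := by
    by_contra! hne
    have hL : (⋂ n, ⋂ i ∈ Finset.range (n + 1), K i).Nonempty := by
      refine IsCompact.nonempty_iInter_of_sequence_nonempty_isCompact_isClosed
        (fun n => ⋂ i ∈ Finset.range (n + 1), K i) (fun n => ?_) hne ?_ (fun n => ?_)
      · exact biInter_subset_biInter_left (Finset.coe_subset.2
          (Finset.range_subset_range.2 (Nat.le_succ _)))
      · simpa using hK 0
      · exact isClosed_biInter fun i _ => (hK i).isClosed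
    obtain ⟨x, hx⟩ := hL
    have : x ∈ ⋂ n, s n := by
      refine mem_iInter.2 fun n => hKs n ?_
      exact mem_iInter₂.1 (mem_iInter.1 hx n) n (Finset.self_mem_range_succ n)
    rw [hempty] at this
    exact this
  have hsub : s n ⊆ ⋃ i ∈ Finset.range (n + 1), s i \ K i := by
    intro x hx
    by_contra hcon
    have : x ∈ ⋂ i ∈ Finset.range (n + 1), K i := by
      refine mem_iInter₂.2 fun i hi => ?_
      by_contra hxi
      exact hcon (mem_iUnion₂.2 ⟨i, hi, anti (Nat.lt_succ_iff.1 (Finset.mem_range.1 hi)) hx, hxi⟩)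
    rw [hn] at this
    exact this
  have hmn : m (s n) ≤ ε := calc
    m (s n) ≤ m (⋃ i ∈ Finset.range (n + 1), s i \ K i) :=
        content_mono (hs n) (Finset.measurableSet_biUnion _ fun i _ => (hs i).diff (mK i)) hsub
    _ ≤ ∑ i ∈ Finset.range (n + 1), m (s i \ K i) :=
        addContent_biUnion_le isSetAlgebra_measurableSet.isSetRing
          fun i _ => (hs i).diff (mK i)
    _ ≤ ∑ i ∈ Finset.range (n + 1), δ i := Finset.sum_le_sum fun i _ => hmK i
    _ ≤ ∑' i, δ i := ENNReal.sum_le_tsum _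
    _ ≤ ε := hδε.le
  filter_upwards [eventually_ge_atTop n] with k hk
  exact (content_mono (hs k) (hs n) (anti hk)).trans hmn

/-- A finite content agrees on a generating family with a measure, provided that the members of
the family and their complements are approximated from inside by compact sets. Only agreement on
the family is claimed: the content itself may fail to be `σ`-additive. -/
theorem exists_measure_eq_content [T2Space Z] (hm : m univ ≠ ∞) {G : Set (Set Z)}
    (hG : ‹MeasurableSpace Z› = MeasurableSpace.generateFrom G)
    (hGa : ∀ s ∈ G, CompactApprox m s ∧ CompactApprox m sᶜ) :
    ∃ π : Measure Z, ∀ s ∈ G, π s = m s := by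
  -- requiring approximation of the complement as well makes the approximable sets an algebra
  let C : Set (Set Z) := {s | MeasurableSet s ∧ CompactApprox m s ∧ CompactApprox m sᶜ}
  have hGmeas : ∀ s ∈ G, MeasurableSet s := fun s hs => by
    rw [hG]; exact MeasurableSpace.measurableSet_generateFrom hs
  have hGC : G ⊆ C := fun s hs => ⟨hGmeas s hs, hGa s hs⟩
  obtain rfl | ⟨s₀, hs₀⟩ := G.eq_empty_or_nonempty
  · exact ⟨0, by simp⟩
  have hCu : ∀ ⦃s t⦄, s ∈ C → t ∈ C → s ∪ t ∈ C := fun s t hs ht => by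
    refine ⟨hs.1.union ht.1, hs.2.1.union hs.1 ht.1 ht.2.1, ?_⟩
    rw [compl_union]
    exact hs.2.2.inter hs.1.compl ht.1.compl ht.2.2
  have hCc : ∀ ⦃s⦄, s ∈ C → sᶜ ∈ C := fun s hs => ⟨hs.1.compl, hs.2.2, by simpa using hs.2.1⟩
  have hCe : ∅ ∈ C := by
    have h := hCc (hCu (hGC hs₀) (hCc (hGC hs₀)))
    rwa [union_compl_self, compl_univ] at h
  have hC : IsSetRing C := (IsSetAlgebra.mk hCe hCc hCu).isSetRing
  let m' : AddContent ℝ≥0∞ C := hC.addContent_of_union m addContent_empty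
    fun hs ht hd => addContent_union isSetAlgebra_measurableSet.isSetRing hs.1 ht.1 hd
  have hm' : ∀ s, m' s = m s := fun _ => rfl
  have hsub : m'.IsSigmaSubadditive := by
    refine isSigmaSubadditive_of_addContent_iUnion_eq_tsum hC fun f hf hU hd => ?_
    refine addContent_iUnion_eq_sum_of_tendsto_zero hC m' (fun s hs => ?_) ?_ hf hU hd
    · exact ne_top_of_le_ne_top hm (content_mono hs.1 MeasurableSet.univ (subset_univ s))
    · intro s hs anti hempty
      exact tendsto_content_zero_of_compactApprox (fun n => (hs n).1) (fun n => (hs n).2.1)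
        anti hempty
  have hCgen : ‹MeasurableSpace Z› = MeasurableSpace.generateFrom C := by
    refine le_antisymm ?_ (MeasurableSpace.generateFrom_le fun s hs => hs.1)
    conv_lhs => rw [hG]
    exact MeasurableSpace.generateFrom_mono hGC
  exact ⟨m'.measure hC.isSetSemiring hCgen.le hsub, fun s hs =>
    (m'.measure_eq hC.isSetSemiring hCgen hsub (hGC hs)).trans (hm' s)⟩

end Extension

/-! ### Setwise limits of measures along an ultrafilter -/

section Limit

theorem tendsto_ultrafilter_lim {α ι : Type*} [TopologicalSpace α] [CompactSpace α]
    (U : Ultrafilter ι) (f : ι → α) : Tendsto f U (𝓝 (U.map f).lim) :=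
  (U.map f).le_nhds_lim

variable {Z ι : Type*} [MeasurableSpace Z] (U : Ultrafilter ι) (ρ : ι → Measure Z)

/-- The setwise limit of a family of measures along an ultrafilter, as a content on the measurable
sets. -/
noncomputable def ultraLimit : AddContent ℝ≥0∞ {s : Set Z | MeasurableSet s} :=
  isSetAlgebra_measurableSet.isSetRing.addContent_of_union
    (fun s => (U.map fun i => ρ i s).lim)
    (tendsto_nhds_unique (tendsto_ultrafilter_lim U fun i => ρ i ∅) (by simp))
    (fun {s t} _ ht hd => tendsto_nhds_unique (tendsto_ultrafilter_lim U fun i => ρ i (s ∪ t)) <| by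
      simpa only [measure_union hd ht] using (tendsto_ultrafilter_lim U fun i => ρ i s).add
        (tendsto_ultrafilter_lim U fun i => ρ i t))

theorem tendsto_ultraLimit (s : Set Z) :
    Tendsto (fun i => ρ i s) U (𝓝 (ultraLimit U ρ s)) :=
  tendsto_ultrafilter_lim U fun i => ρ i s

theorem ultraLimit_eq_of_forall_eq {s : Set Z} {c : ℝ≥0∞} (h : ∀ i, ρ i s = c) :
    ultraLimit U ρ s = c :=
  tendsto_nhds_unique (tendsto_ultraLimit U ρ s) (by simpa only [h] using tendsto_const_nhds)

end Limit

/-! ### Compactness of couplings -/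

section Couplings

variable {X Y : Type*} [TopologicalSpace X] [T2Space X] [MeasurableSpace X] [BorelSpace X]
  [TopologicalSpace Y] [T2Space Y] [MeasurableSpace Y] [BorelSpace Y]

/-- A content on a product whose marginals are finite Radon measures approximates every measurable
rectangle by rectangles with compact sides. -/
theorem compactApprox_prod {m : AddContent ℝ≥0∞ {s : Set (X × Y) | MeasurableSet s}}
    {μ : Measure X} {ν : Measure Y} [IsFiniteMeasure μ] [IsFiniteMeasure ν]
    [μ.InnerRegularCompactLTTop] [ν.InnerRegularCompactLTTop]
    (hμ : ∀ A, MeasurableSet A → m (A ×ˢ univ) = μ A)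
    (hν : ∀ B, MeasurableSet B → m (univ ×ˢ B) = ν B)
    {A : Set X} {B : Set Y} (hA : MeasurableSet A) (hB : MeasurableSet B) :
    CompactApprox m (A ×ˢ B) := by
  intro ε hε
  have hε2 : ε / 2 ≠ 0 := (ENNReal.half_pos hε).ne'
  obtain ⟨K, hKA, hK, hmK⟩ := hA.exists_isCompact_sdiff_lt (measure_ne_top μ A) hε2
  obtain ⟨L, hLB, hL, hmL⟩ := hB.exists_isCompact_sdiff_lt (measure_ne_top ν B) hε2
  have mK := hA.diff hK.measurableSet
  have mL := hB.diff hL.measurableSet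
  refine ⟨K ×ˢ L, prod_mono hKA hLB, hK.prod hL, hK.measurableSet.prod hL.measurableSet, ?_⟩
  have hsub : A ×ˢ B \ K ×ˢ L ⊆ (A \ K) ×ˢ univ ∪ univ ×ˢ (B \ L) := by
    rintro ⟨x, y⟩ h
    simp only [Set.mem_sdiff, mem_union, mem_prod, mem_univ] at h ⊢
    tauto
  calc m (A ×ˢ B \ K ×ˢ L) ≤ m ((A \ K) ×ˢ univ ∪ univ ×ˢ (B \ L)) :=
        content_mono ((hA.prod hB).diff (hK.measurableSet.prod hL.measurableSet))
          ((mK.prod MeasurableSet.univ).union (MeasurableSet.univ.prod mL)) hsub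
    _ ≤ m ((A \ K) ×ˢ univ) + m (univ ×ˢ (B \ L)) :=
        content_union_le (mK.prod MeasurableSet.univ) (MeasurableSet.univ.prod mL)
    _ ≤ ε / 2 + ε / 2 := by
        rw [hμ _ mK, hν _ mL]
        exact add_le_add hmK.le hmL.le
    _ = ε := ENNReal.add_halves ε

/-- Compactness of the set of couplings of two finite Radon measures: along an ultrafilter, any
family of couplings converges on measurable rectangles to a measure. No topology on the set of
measures is involved, so that the spaces need not be locally compact. -/
theorem exists_measure_tendsto_prod {ι : Type*} (U : Ultrafilter ι)
    {μ : Measure X} {ν : Measure Y} [IsFiniteMeasure μ] [IsFiniteMeasure ν]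
    [μ.InnerRegularCompactLTTop] [ν.InnerRegularCompactLTTop]
    (ρ : ι → Measure (X × Y)) (hfst : ∀ i, (ρ i).fst = μ) (hsnd : ∀ i, (ρ i).snd = ν) :
    ∃ π : Measure (X × Y), ∀ A B, MeasurableSet A → MeasurableSet B →
      Tendsto (fun i => ρ i (A ×ˢ B)) U (𝓝 (π (A ×ˢ B))) := by
  have hμ : ∀ A, MeasurableSet A → ultraLimit U ρ (A ×ˢ univ) = μ A := fun A hA =>
    ultraLimit_eq_of_forall_eq U ρ fun i => by
      rw [← hfst i, Measure.fst_apply hA, prod_univ]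
  have hν : ∀ B, MeasurableSet B → ultraLimit U ρ (univ ×ˢ B) = ν B := fun B hB =>
    ultraLimit_eq_of_forall_eq U ρ fun i => by
      rw [← hsnd i, Measure.snd_apply hB, univ_prod]
  obtain ⟨π, hπ⟩ := exists_measure_eq_content (m := ultraLimit U ρ)
    (G := image2 (· ×ˢ ·) {s : Set X | MeasurableSet s} {t : Set Y | MeasurableSet t})
    (by rw [← univ_prod_univ, hμ _ MeasurableSet.univ]; exact measure_ne_top μ univ)
    generateFrom_prod.symm
    (by
      rintro _ ⟨A, hA, B, hB, rfl⟩
      refine ⟨compactApprox_prod hμ hν hA hB, ?_⟩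
      rw [compl_prod_eq_union]
      exact (compactApprox_prod hμ hν hA.compl MeasurableSet.univ).union
        (hA.compl.prod MeasurableSet.univ) (MeasurableSet.univ.prod hB.compl)
        (compactApprox_prod hμ hν MeasurableSet.univ hB.compl))
  exact ⟨π, fun A B hA hB => hπ (A ×ˢ B) ⟨A, hA, B, hB, rfl⟩ ▸ tendsto_ultraLimit U ρ (A ×ˢ B)⟩

end Couplings

/-! ### Densities with respect to the total measure -/

section Densities

variable {X : Type*} [MeasurableSpace X] {J : ℕ}

instance (μ : Fin J → Measure X) [∀ j, IsFiniteMeasure (μ j)] : IsFiniteMeasure (total μ) := by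
  unfold total; infer_instance

theorem total_apply (μ : Fin J → Measure X) (s : Set X) : total μ s = ∑ j, μ j s := by
  simp [total]

theorem le_total (μ : Fin J → Measure X) (j : Fin J) : μ j ≤ total μ :=
  Measure.le_iff'.2 fun s => by
    rw [total_apply]
    exact Finset.single_le_sum (f := fun j => μ j s) (fun _ _ => zero_le) (Finset.mem_univ j)

variable (μ : Fin J → Measure X) [∀ j, IsFiniteMeasure (μ j)]

theorem withDensity_rnDeriv_total (j : Fin J) :
    (total μ).withDensity ((μ j).rnDeriv (total μ)) = μ j :=
  Measure.withDensity_rnDeriv_eq _ _ (le_total μ j).absolutelyContinuous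

theorem sum_rnDeriv_total_ae_eq_one :
    (fun x => ∑ j, (μ j).rnDeriv (total μ) x) =ᵐ[total μ] fun _ => 1 := by
  have hmeas : Measurable fun x => ∑ j, (μ j).rnDeriv (total μ) x :=
    Finset.measurable_fun_sum _ fun j _ => Measure.measurable_rnDeriv _ _
  refine ae_eq_of_forall_setLIntegral_eq_of_sigmaFinite hmeas measurable_const fun s hs _ => ?_
  rw [lintegral_finsetSum _ fun j _ => Measure.measurable_rnDeriv _ _, setLIntegral_one,
    total_apply]
  refine Finset.sum_congr rfl fun j _ => ?_
  rw [← withDensity_apply _ hs, withDensity_rnDeriv_total]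

/-- The real-valued moments of `p ≤ |μ̄|` are the real values of the extended nonnegative ones. -/
theorem integral_rnDeriv_total {p : Measure X} (hp : p ≤ total μ) (j : Fin J) :
    ∫ x, ((μ j).rnDeriv (total μ) x).toReal ∂p
      = (∫⁻ x, (μ j).rnDeriv (total μ) x ∂p).toReal :=
  integral_toReal (Measure.measurable_rnDeriv _ _).aemeasurable
    (hp.absolutelyContinuous.ae_le (Measure.rnDeriv_lt_top _ _))

theorem lintegral_rnDeriv_total_ne_top {p : Measure X} (hp : p ≤ total μ) (j : Fin J) :
    ∫⁻ x, (μ j).rnDeriv (total μ) x ∂p ≠ ∞ :=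
  ne_top_of_le_ne_top (Measure.lintegral_rnDeriv_lt_top (μ j) (total μ)).ne
    (lintegral_mono' hp le_rfl)

theorem sum_lintegral_rnDeriv_total {p : Measure X} (hp : p ≤ total μ) :
    ∑ j, ∫⁻ x, (μ j).rnDeriv (total μ) x ∂p = p univ := by
  rw [← lintegral_finsetSum _ fun j _ => Measure.measurable_rnDeriv _ _,
    lintegral_congr_ae (hp.absolutelyContinuous.ae_le (sum_rnDeriv_total_ae_eq_one μ)),
    lintegral_one]

theorem IsWeakPartition.le {N : ℕ} {m : Measure X} {p : Fin N → Measure X}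
    (h : IsWeakPartition m p) (i : Fin N) : p i ≤ m :=
  h ▸ le_total p i

theorem congruent_iff_lintegral {Y : Type*} [MeasurableSpace Y] {N : ℕ} (ν : Fin J → Measure Y)
    [∀ j, IsFiniteMeasure (ν j)] {p : Fin N → Measure X} {q : Fin N → Measure Y}
    (hp : IsWeakPartition (total μ) p) (hq : IsWeakPartition (total ν) q) :
    Congruent μ ν p q ↔ ∀ i j, ∫⁻ x, (μ j).rnDeriv (total μ) x ∂(p i) =
      ∫⁻ y, (ν j).rnDeriv (total ν) y ∂(q i) := by
  refine forall_congr' fun i => forall_congr' fun j => ?_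
  rw [integral_rnDeriv_total μ (hp.le i), integral_rnDeriv_total ν (hq.le i),
    ENNReal.toReal_eq_toReal_iff' (lintegral_rnDeriv_total_ne_top μ (hp.le i) j)
      (lintegral_rnDeriv_total_ne_top ν (hq.le i) j)]

/-- Weighting by a measurable partition of unity splits a measure into a sum. -/
theorem sum_withDensity_of_sum_ae_eq_one {N : ℕ} {m : Measure X} {g : Fin N → X → ℝ≥0∞}
    (hg : ∀ i, Measurable (g i)) (h : (fun x => ∑ i, g i x) =ᵐ[m] fun _ => 1) :
    ∑ i, m.withDensity (g i) = m := by
  ext s hs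
  simp only [Measure.coe_finsetSum, Finset.sum_apply]
  simp_rw [withDensity_apply _ hs]
  rw [← lintegral_finsetSum _ fun i _ => hg i, lintegral_congr_ae (ae_restrict_of_ae h),
    setLIntegral_one]

end Densities

/-! ### From domination to congruent weak partitions -/

section Forward

variable {X Y : Type*} [MeasurableSpace X] [MeasurableSpace Y] {J : ℕ}
  {μ : Fin J → Measure X} {ν : Fin J → Measure Y} [∀ j, IsFiniteMeasure (μ j)]

/-- The densities sum to `1` almost everywhere, so a measure witnessing domination is a coupling of
`|μ̄|` and `|ν̄|`. -/
theorem snd_eq_total_of_dominates {π : Measure (X × Y)} (hfst : π.fst = total μ)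
    (hπ : ∀ j, (π.withDensity fun z => (μ j).rnDeriv (total μ) z.1).snd = ν j) :
    π.snd = total ν := by
  have hone : (fun z : X × Y => ∑ j, (μ j).rnDeriv (total μ) z.1) =ᵐ[π] fun _ => 1 :=
    ae_of_ae_map (p := fun x => ∑ j, (μ j).rnDeriv (total μ) x = 1) measurable_fst.aemeasurable
      (by
        change ∀ᵐ x ∂π.fst, _
        rw [hfst]
        exact sum_rnDeriv_total_ae_eq_one μ)
  have hsum := sum_withDensity_of_sum_ae_eq_one
    (fun j => (Measure.measurable_rnDeriv (μ j) (total μ)).comp measurable_fst) hone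
  ext B hB
  rw [total_apply, Measure.snd_apply hB]
  conv_lhs => rw [← hsum]
  simp only [Measure.coe_finsetSum, Finset.sum_apply]
  refine Finset.sum_congr rfl fun j _ => ?_
  rw [← hπ j, Measure.snd_apply hB]
  rfl

/-- The coupling transports a weak partition `q` of `|ν̄|` back to `X`: weight it by the density
`dq_i / d|ν̄|` in the second variable and take the first marginal. -/
theorem Dominates.exists_congruent [∀ j, IsFiniteMeasure (ν j)] (h : Dominates μ ν) {N : ℕ} {q : Fin N → Measure Y}
    (hq : IsWeakPartition (total ν) q) :
    ∃ p : Fin N → Measure X, IsWeakPartition (total μ) p ∧ Congruent μ ν p q := by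
  obtain ⟨π, hfst, hπ⟩ := h
  have hsnd := snd_eq_total_of_dominates hfst hπ
  have : ∀ i, IsFiniteMeasure (q i) := fun i => isFiniteMeasure_of_le _ (hq.le i)
  let g : Fin N → Y → ℝ≥0∞ := fun i => (q i).rnDeriv (total ν)
  have hg : ∀ i, Measurable (g i) := fun i => Measure.measurable_rnDeriv _ _
  have hg' : ∀ i, Measurable fun z : X × Y => g i z.2 := fun i => (hg i).comp measurable_snd
  have hf : ∀ j, Measurable ((μ j).rnDeriv (total μ)) := fun j => Measure.measurable_rnDeriv _ _
  have hf' : ∀ j, Measurable fun z : X × Y => (μ j).rnDeriv (total μ) z.1 :=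
    fun j => (hf j).comp measurable_fst
  have hone : (fun z : X × Y => ∑ i, g i z.2) =ᵐ[π] fun _ => 1 := by
    refine ae_of_ae_map (p := fun y => ∑ i, g i y = 1) measurable_snd.aemeasurable ?_
    change ∀ᵐ y ∂π.snd, _
    rw [hsnd, ← show total q = total ν from hq]
    have := sum_rnDeriv_total_ae_eq_one q
    filter_upwards [this] with y hy
    simpa only [g, ← show total q = total ν from hq] using hy
  have hp : IsWeakPartition (total μ) fun i => (π.withDensity fun z => g i z.2).fst := by
    ext A hA
    rw [← hfst, Measure.fst_apply hA]
    conv_rhs => rw [← sum_withDensity_of_sum_ae_eq_one hg' hone]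
    simp only [Measure.coe_finsetSum, Finset.sum_apply]
    exact Finset.sum_congr rfl fun i _ => Measure.fst_apply hA
  refine ⟨_, hp, (congruent_iff_lintegral μ ν hp hq).2 fun i j => ?_⟩
  calc ∫⁻ x, (μ j).rnDeriv (total μ) x ∂(π.withDensity fun z => g i z.2).fst
      = ∫⁻ z, (μ j).rnDeriv (total μ) z.1 ∂(π.withDensity fun z => g i z.2) :=
        lintegral_map (hf j) measurable_fst
    _ = ∫⁻ z, g i z.2 * (μ j).rnDeriv (total μ) z.1 ∂π :=
        lintegral_withDensity_eq_lintegral_mul _ (hg' i) (hf' j)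
    _ = ∫⁻ z, (μ j).rnDeriv (total μ) z.1 * g i z.2 ∂π := by simp only [mul_comm]
    _ = ∫⁻ z, g i z.2 ∂(π.withDensity fun z => (μ j).rnDeriv (total μ) z.1) :=
        (lintegral_withDensity_eq_lintegral_mul _ (hf' j) (hg' i)).symm
    _ = ∫⁻ y, g i y ∂(ν j) := by rw [← hπ j]; exact (lintegral_map (hg i) measurable_snd).symm
    _ = ∫⁻ y, (ν j).rnDeriv (total ν) y * g i y ∂(total ν) := by
        conv_lhs => rw [← withDensity_rnDeriv_total ν j]
        exact lintegral_withDensity_eq_lintegral_mul _ (Measure.measurable_rnDeriv _ _) (hg i)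
    _ = ∫⁻ y, g i y * (ν j).rnDeriv (total ν) y ∂(total ν) := by simp only [mul_comm]
    _ = ∫⁻ y, (ν j).rnDeriv (total ν) y ∂(q i) := by
        conv_rhs => rw [← Measure.withDensity_rnDeriv_eq _ _ (hq.le i).absolutelyContinuous]
        exact (lintegral_withDensity_eq_lintegral_mul _ (hg i)
          (Measure.measurable_rnDeriv _ _)).symm

end Forward

/-! ### Couplings for finitely many sets -/

section Backward

variable {X Y : Type*} [MeasurableSpace X] [MeasurableSpace Y] {J : ℕ}

/-- Finitely many measurable sets are unions of the fibres of one measurable map to a finite set,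
namely the classification by membership in each of them. -/
theorem exists_measurable_fin_preimage (S : Finset {B : Set Y // MeasurableSet B}) :
    ∃ N : ℕ, 1 ≤ N ∧ ∃ φ : Y → Fin N, Measurable φ ∧
      ∀ B ∈ S, ∃ T : Finset (Fin N), B.1 = φ ⁻¹' T := by
  classical
  let e := Fintype.equivFin (S → Bool)
  let ψ : Y → S → Bool := fun y B => decide (y ∈ B.1.1)
  have hψ : Measurable ψ := measurable_pi_lambda _ fun B => by
    refine measurable_to_bool ?_
    convert B.1.2 using 1
    ext y
    simp [ψ]
  refine ⟨_, Fintype.card_pos, fun y => e (ψ y), (Measurable.of_discrete (f := e)).comp hψ,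
    fun B hB => ⟨Finset.univ.filter fun k => e.symm k ⟨B, hB⟩ = true, ?_⟩⟩
  ext y
  simp [ψ]

/-- The measure `∑ i, p i ⊗ ν(· | φ = i)`: given the cell `i`, the two variables are
independent. A cell with `ν (φ = i) = 0` is weighted by `0⁻¹ = ∞`, but restricting `ν` to it gives
the zero measure. -/
noncomputable def cellCoupling {N : ℕ} (p : Fin N → Measure X) (ν : Measure Y) (φ : Y → Fin N) :
    Measure (X × Y) :=
  ∑ i, (p i).prod ((ν (φ ⁻¹' {i}))⁻¹ • ν.restrict (φ ⁻¹' {i}))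

variable {N : ℕ} {p : Fin N → Measure X} {ν : Measure Y} {φ : Y → Fin N}

theorem cellCoupling_prod [IsFiniteMeasure ν] {A : Set X} {B : Set Y} (hB : MeasurableSet B) :
    cellCoupling p ν φ (A ×ˢ B)
      = ∑ i, p i A * ((ν (φ ⁻¹' {i}))⁻¹ * ν (B ∩ φ ⁻¹' {i})) := by
  simp [cellCoupling, Measure.restrict_apply hB]

theorem ennreal_mul_inv_mul_cancel {a b : ℝ≥0∞} (hab : a ≤ b) (hb : b ≠ ∞) :
    a * (b⁻¹ * b) = a := by
  rcases eq_or_ne b 0 with rfl | h0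
  · simp [nonpos_iff_eq_zero.1 hab]
  · rw [ENNReal.inv_mul_cancel h0 hb, mul_one]

theorem fst_cellCoupling [IsFiniteMeasure ν] (hp : ∀ i, p i univ = ν (φ ⁻¹' {i})) :
    (cellCoupling p ν φ).fst = ∑ i, p i := by
  ext A hA
  rw [Measure.fst_apply hA, ← prod_univ, cellCoupling_prod MeasurableSet.univ]
  simp only [univ_inter, Measure.coe_finsetSum, Finset.sum_apply]
  exact Finset.sum_congr rfl fun i _ => ennreal_mul_inv_mul_cancel
    ((measure_mono (subset_univ A)).trans_eq (hp i)) (measure_ne_top ν _)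

theorem snd_cellCoupling [IsFiniteMeasure ν] (hφ : Measurable φ)
    (hp : ∀ i, p i univ = ν (φ ⁻¹' {i})) : (cellCoupling p ν φ).snd = ν := by
  ext B hB
  rw [Measure.snd_apply hB, ← univ_prod, cellCoupling_prod hB]
  have hcell : ∀ i, p i univ * ((ν (φ ⁻¹' {i}))⁻¹ * ν (B ∩ φ ⁻¹' {i}))
      = ν.restrict B (φ ⁻¹' {i}) := fun i => by
    rw [hp i, Measure.restrict_apply (hφ (measurableSet_singleton i)), inter_comm,
      ← mul_assoc, mul_comm, mul_comm (ν _) (ν _)⁻¹]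
    exact ennreal_mul_inv_mul_cancel (measure_mono inter_subset_left) (measure_ne_top ν _)
  simp only [hcell]
  rw [sum_measure_preimage_singleton _ fun i _ => hφ (measurableSet_singleton i)]
  simp

/-- On a union of cells, the moments of the coupling are at most those prescribed by `p`. -/
theorem setLIntegral_cellCoupling_le [IsFiniteMeasure ν] [∀ i, IsFiniteMeasure (p i)]
    (hφ : Measurable φ) {f : X → ℝ≥0∞} (hf : Measurable f) (T : Finset (Fin N)) :
    ∫⁻ z in Prod.snd ⁻¹' (φ ⁻¹' T), f z.1 ∂(cellCoupling p ν φ) ≤ ∑ i ∈ T, ∫⁻ x, f x ∂(p i) := by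
  have hT : MeasurableSet (φ ⁻¹' (T : Set (Fin N))) := hφ T.measurableSet
  have hcell : ∀ i, ∫⁻ z in Prod.snd ⁻¹' (φ ⁻¹' T), f z.1
      ∂((p i).prod ((ν (φ ⁻¹' {i}))⁻¹ • ν.restrict (φ ⁻¹' {i})))
      = (∫⁻ x, f x ∂(p i)) * ((ν (φ ⁻¹' {i}))⁻¹ * ν (φ ⁻¹' T ∩ φ ⁻¹' {i})) := fun i => by
    rw [← univ_prod, ← Measure.prod_restrict, Measure.restrict_univ]
    have := lintegral_prod_mul (μ := p i)
      (ν := ((ν (φ ⁻¹' {i}))⁻¹ • ν.restrict (φ ⁻¹' {i})).restrict (φ ⁻¹' T))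
      hf.aemeasurable (g := fun _ => 1) aemeasurable_const
    simpa [Measure.restrict_apply hT] using this
  rw [cellCoupling, ← Measure.sum_fintype, Measure.restrict_sum _ (measurable_snd hT),
    lintegral_sum_measure, tsum_fintype, ← Finset.sum_subset (Finset.subset_univ T)]
  · refine Finset.sum_le_sum fun i _ => (hcell i).trans_le ?_
    refine mul_le_of_le_one_right' ((mul_le_mul_right (measure_mono inter_subset_right) _).trans ?_)
    exact ENNReal.inv_mul_le_one _
  · intro i _ hi
    rw [hcell, ← preimage_inter, inter_singleton_eq_empty.2 (by simpa using hi)]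
    simp

/-- Fatou's lemma for setwise convergence of measures. -/
theorem lintegral_le_of_tendsto_measure {ι : Type*} {l : Filter ι} [l.NeBot]
    {τ : ι → Measure X} {τ' : Measure X}
    (h : ∀ A, MeasurableSet A → Tendsto (fun i => τ i A) l (𝓝 (τ' A))) (f : X → ℝ≥0∞) {c : ℝ≥0∞}
    (hc : ∀ᶠ i in l, ∫⁻ x, f x ∂(τ i) ≤ c) : ∫⁻ x, f x ∂τ' ≤ c := by
  rw [lintegral_eq_nnreal]
  refine iSup₂_le fun g hg => ?_
  have hlim : Tendsto (fun i => (g.map ((↑) : NNReal → ℝ≥0∞)).lintegral (τ i)) l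
      (𝓝 ((g.map ((↑) : NNReal → ℝ≥0∞)).lintegral τ')) := by
    simp only [SimpleFunc.map_lintegral]
    exact tendsto_finsetSum _ fun r _ => ENNReal.Tendsto.const_mul
      (h _ (g.measurableSet_fiber r)) (Or.inr ENNReal.coe_ne_top)
  refine le_of_tendsto hlim (hc.mono fun i hi => ?_)
  rw [← SimpleFunc.lintegral_eq_lintegral]
  exact (lintegral_mono hg).trans hi

theorem ennreal_eq_of_le_of_sum_eq {ι : Type*} [Fintype ι] {a b : ι → ℝ≥0∞}
    (hb : ∀ i, b i ≠ ∞) (hle : ∀ i, a i ≤ b i) (hsum : ∑ i, a i = ∑ i, b i) (i : ι) :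
    a i = b i := by
  classical
  refine le_antisymm (hle i) ?_
  have hrest : ∑ k ∈ Finset.univ.erase i, b k ≠ ∞ := ENNReal.sum_ne_top.2 fun k _ => hb k
  refine (ENNReal.add_le_add_iff_right hrest).1 ?_
  rw [Finset.add_sum_erase _ _ (Finset.mem_univ i), ← hsum,
    ← Finset.add_sum_erase _ a (Finset.mem_univ i)]
  gcongr with k
  exact hle k

/-- Congruence for the partition of `|ν̄|` into cells yields a coupling of `|μ̄|` and `|ν̄|` with the
required conditional moments on finitely many prescribed sets. -/
theorem exists_coupling_of_congruent {μ : Fin J → Measure X} {ν : Fin J → Measure Y}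
    [∀ j, IsFiniteMeasure (μ j)] [∀ j, IsFiniteMeasure (ν j)]
    (h : ∀ N : ℕ, 1 ≤ N → ∀ q : Fin N → Measure Y, IsWeakPartition (total ν) q →
      ∃ p : Fin N → Measure X, IsWeakPartition (total μ) p ∧ Congruent μ ν p q)
    (S : Finset {B : Set Y // MeasurableSet B}) :
    ∃ ρ : Measure (X × Y), ρ.fst = total μ ∧ ρ.snd = total ν ∧ ∀ B ∈ S, ∀ j,
      ∫⁻ z in Prod.snd ⁻¹' B.1, (μ j).rnDeriv (total μ) z.1 ∂ρ ≤ ν j B.1 := by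
  obtain ⟨N, hN, φ, hφ, hS⟩ := exists_measurable_fin_preimage S
  have hφi : ∀ i, MeasurableSet (φ ⁻¹' {i}) := fun i => hφ (measurableSet_singleton i)
  have hq : IsWeakPartition (total ν) fun i => (total ν).restrict (φ ⁻¹' {i}) := by
    ext B hB
    simp only [Measure.coe_finsetSum, Finset.sum_apply]
    have := sum_measure_preimage_singleton (μ := (total ν).restrict B) Finset.univ
      fun i _ => hφi i
    simpa [Measure.restrict_apply, hB, hφi, inter_comm] using this
  obtain ⟨p, hp, hpq⟩ := h N hN _ hq
  have hmom : ∀ i j, ∫⁻ x, (μ j).rnDeriv (total μ) x ∂(p i) = ν j (φ ⁻¹' {i}) := fun i j => by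
    rw [(congruent_iff_lintegral μ ν hp hq).1 hpq i j, ← withDensity_apply _ (hφi i),
      withDensity_rnDeriv_total]
  have hpu : ∀ i, p i univ = total ν (φ ⁻¹' {i}) := fun i => by
    rw [← sum_lintegral_rnDeriv_total μ (hp.le i), total_apply]
    exact Finset.sum_congr rfl fun j _ => hmom i j
  have : ∀ i, IsFiniteMeasure (p i) := fun i => isFiniteMeasure_of_le _ (hp.le i)
  refine ⟨cellCoupling p (total ν) φ, (fst_cellCoupling hpu).trans hp, snd_cellCoupling hφ hpu,
    fun B hB j => ?_⟩
  obtain ⟨T, hT⟩ := hS B hB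
  rw [hT]
  refine (setLIntegral_cellCoupling_le hφ (Measure.measurable_rnDeriv _ _) T).trans_eq ?_
  rw [← sum_measure_preimage_singleton T fun i _ => hφi i]
  exact Finset.sum_congr rfl fun i _ => hmom i j

end Backward

/-! ### From congruent weak partitions to domination -/

section Main

instance innerRegular_total {X : Type*} [TopologicalSpace X] [MeasurableSpace X] {J : ℕ}
    (μ : Fin J → Measure X) [∀ j, (μ j).InnerRegular] : (total μ).InnerRegular := by
  unfold total; infer_instance

variable {X Y : Type*} [TopologicalSpace X] [T2Space X] [MeasurableSpace X] [BorelSpace X]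
  [TopologicalSpace Y] [T2Space Y] [MeasurableSpace Y] [BorelSpace Y] {J : ℕ}
  {μ : Fin J → Measure X} {ν : Fin J → Measure Y}
  [∀ j, IsFiniteMeasure (μ j)] [∀ j, IsFiniteMeasure (ν j)]

/-- The couplings attached to finite families of measurable sets of `Y` converge along an
ultrafilter refining the directed set of such families. Fatou's lemma leaves only an inequality
between the conditional moments of the limit and `ν`; since both sides have the same sum over `j`,
it is an equality. -/
theorem dominates_of_forall_exists_congruent [∀ j, (μ j).Regular] [∀ j, (ν j).Regular]
    (h : ∀ N : ℕ, 1 ≤ N → ∀ q : Fin N → Measure Y, IsWeakPartition (total ν) q →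
      ∃ p : Fin N → Measure X, IsWeakPartition (total μ) p ∧ Congruent μ ν p q) :
    Dominates μ ν := by
  choose ρ hfst hsnd hρ using exists_coupling_of_congruent h
  let U : Ultrafilter (Finset {B : Set Y // MeasurableSet B}) := Ultrafilter.of atTop
  obtain ⟨π, hπ⟩ := exists_measure_tendsto_prod U ρ hfst hsnd
  have hπfst : π.fst = total μ := by
    ext A hA
    rw [Measure.fst_apply hA, ← prod_univ]
    refine tendsto_nhds_unique (hπ A univ hA MeasurableSet.univ) ?_
    simp_rw [prod_univ, ← Measure.fst_apply hA, hfst]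
    exact tendsto_const_nhds
  have hπsnd : π.snd = total ν := by
    ext B hB
    rw [Measure.snd_apply hB, ← univ_prod]
    refine tendsto_nhds_unique (hπ univ B MeasurableSet.univ hB) ?_
    simp_rw [univ_prod, ← Measure.snd_apply hB, hsnd]
    exact tendsto_const_nhds
  have hf : ∀ j, Measurable ((μ j).rnDeriv (total μ)) := fun j => Measure.measurable_rnDeriv _ _
  -- the first marginal of the part of a measure living over `B`
  let slice : Measure (X × Y) → Set Y → Measure X := fun σ B => (σ.restrict (Prod.snd ⁻¹' B)).fst
  have hslice : ∀ σ A B, MeasurableSet A → slice σ B A = σ (A ×ˢ B) := fun σ A B hA => by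
    rw [Measure.fst_apply hA, Measure.restrict_apply (measurable_fst hA)]
    rfl
  have hmom : ∀ σ B j, ∫⁻ z in Prod.snd ⁻¹' B, (μ j).rnDeriv (total μ) z.1 ∂σ
      = ∫⁻ x, (μ j).rnDeriv (total μ) x ∂(slice σ B) := fun σ B j =>
    (lintegral_map (hf j) measurable_fst).symm
  have hle : ∀ B, MeasurableSet B → ∀ j,
      ∫⁻ x, (μ j).rnDeriv (total μ) x ∂(slice π B) ≤ ν j B := fun B hB j => by
    refine lintegral_le_of_tendsto_measure (l := (U : Filter _)) (τ := fun S => slice (ρ S) B)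
      (fun A hA => ?_) _ (Ultrafilter.of_le atTop ?_)
    · simpa only [hslice _ _ _ hA] using hπ A B hA hB
    · filter_upwards [eventually_ge_atTop {⟨B, hB⟩}] with S hS
      rw [← hmom]
      exact hρ S ⟨B, hB⟩ (hS (Finset.mem_singleton_self _)) j
  refine ⟨π, hπfst, fun j => ?_⟩
  ext B hB
  rw [Measure.snd_apply hB, withDensity_apply _ (measurable_snd hB), hmom]
  refine ennreal_eq_of_le_of_sum_eq (fun j => measure_ne_top (ν j) B) (hle B hB) ?_ j
  have hsliceμ : slice π B ≤ total μ := hπfst ▸ Measure.fst_mono Measure.restrict_le_self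
  rw [sum_lintegral_rnDeriv_total μ hsliceμ, hslice _ _ _ MeasurableSet.univ, univ_prod,
    ← Measure.snd_apply hB, hπsnd, total_apply]

end Main

theorem feasibilitySet_subset_iff {X Y : Type*} [MeasurableSpace X] [MeasurableSpace Y] {J : ℕ}
    (N : ℕ) (μ : Fin J → Measure X) (ν : Fin J → Measure Y) :
    feasibilitySet N ν ⊆ feasibilitySet N μ ↔
      ∀ q : Fin N → Measure Y, IsWeakPartition (total ν) q →
        ∃ p : Fin N → Measure X, IsWeakPartition (total μ) p ∧ Congruent μ ν p q := by
  constructor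
  · intro h q hq
    obtain ⟨p, hp, hpq⟩ := h ⟨q, hq, rfl⟩
    exact ⟨p, hp, fun i j => congrFun (congrFun hpq i) j⟩
  · rintro h _ ⟨q, hq, rfl⟩
    obtain ⟨p, hp, hpq⟩ := h q hq
    exact ⟨p, hp, Matrix.ext hpq⟩

end VectorDominance

theorem mainTheorem3 {X Y : Type*}
    [TopologicalSpace X] [T2Space X] [MeasurableSpace X] [BorelSpace X]
    [TopologicalSpace Y] [T2Space Y] [MeasurableSpace Y] [BorelSpace Y]
    (J : ℕ) (μ : Fin J → Measure X) (ν : Fin J → Measure Y)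
    [∀ j, IsFiniteMeasure (μ j)] [∀ j, (μ j).Regular]
    [∀ j, IsFiniteMeasure (ν j)] [∀ j, (ν j).Regular] :
    (VectorDominance.Dominates μ ν ↔
      ∀ N : ℕ, 1 ≤ N →
        VectorDominance.feasibilitySet N ν ⊆ VectorDominance.feasibilitySet N μ) ∧
    (VectorDominance.Dominates μ ν ↔
      ∀ N : ℕ, 1 ≤ N → ∀ q : Fin N → Measure Y,
        VectorDominance.IsWeakPartition (VectorDominance.total ν) q →
          ∃ p : Fin N → Measure X,
            VectorDominance.IsWeakPartition (VectorDominance.total μ) p ∧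
              VectorDominance.Congruent μ ν p q) := by
  have key : VectorDominance.Dominates μ ν ↔
      ∀ N : ℕ, 1 ≤ N → ∀ q : Fin N → Measure Y,
        VectorDominance.IsWeakPartition (VectorDominance.total ν) q →
          ∃ p : Fin N → Measure X,
            VectorDominance.IsWeakPartition (VectorDominance.total μ) p ∧
              VectorDominance.Congruent μ ν p q :=
    ⟨fun h _ _ _ hq => h.exists_congruent hq,
      VectorDominance.dominates_of_forall_exists_congruent⟩
  refine ⟨key.trans ?_, key⟩
  exact forall₂_congr fun N _ => (VectorDominance.feasibilitySet_subset_iff N μ ν).symm
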